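/- Let $p$ be a prime. A quasigroup is a set $Q$ with a binary operation $*$ such that for all $a,b\in Q$ each of the equations $a*x=b$ and $x*a=b$ has a unique solution $x\in Q$; it is medial if $(x*y)*(u*v)=(x*u)*(y*v)$ for all $x,y,u,v\in Q$. A quasigroup $Q$ admits an affine form over an abelian group $G$ if it is isomorphic to $(G,*)$ with $x*y=\varphi(x)+\psi(y)+c$ for some automorphisms $\varphi,\psi$ of $G$ and some $c\in G$. Then the number of isomorphism classes of medial quasigroups that admit an affine form over the group $\mathbb{Z}_p^2$ is exactly $p^4-p^2-p-1$. -/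

import Mathlib

universe u v

/-- A (bundled) medial quasigroup: a set with a binary operation `*` in which the equations
`a * x = b` and `x * a = b` are uniquely solvable, and which satisfies the medial law. -/
structure MedialQuasigroup : Type (u + 1) where
  /-- the underlying set -/
  carrier : Type u
  /-- the operation -/
  [mul : Mul carrier]
  existsUnique_right : ∀ a b : carrier, ∃! x : carrier, a * x = b
  existsUnique_left : ∀ a b : carrier, ∃! x : carrier, x * a = b
  medial : ∀ x y s t : carrier, (x * y) * (s * t) = (x * s) * (y * t)

attribute [instance] MedialQuasigroup.mul

/-- `Q` admits an affine form over the abelian group `G`: it is isomorphic to the set `G` with the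
operation `x * y = φ x + ψ y + c` for some automorphisms `φ`, `ψ` of `G` and some `c` in `G`. -/
def MedialQuasigroup.AdmitsAffineForm (Q : MedialQuasigroup.{u}) (G : Type v) [AddCommGroup G] :
    Prop :=
  ∃ (φ ψ : G ≃+ G) (c : G) (e : Q.carrier ≃ G),
    ∀ x y : Q.carrier, e (x * y) = φ (e x) + ψ (e y) + c

/-- Isomorphism, as an equivalence relation on the medial quasigroups that admit an affine form
over `G`. -/
def medialQuasigroupSetoid (G : Type v) [AddCommGroup G] :
    Setoid {Q : MedialQuasigroup.{u} // Q.AdmitsAffineForm G} where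
  r A B := Nonempty (A.1.carrier ≃* B.1.carrier)
  iseqv :=
    { refl := fun A => ⟨MulEquiv.refl A.1.carrier⟩
      symm := fun ⟨f⟩ => ⟨f.symm⟩
      trans := fun ⟨f⟩ ⟨g⟩ => ⟨f.trans g⟩ }

/-- The number of medial quasigroups (with underlying set in `Type u`) that admit an affine form
over `G`, up to isomorphism. -/
noncomputable def mq (G : Type v) [AddCommGroup G] : ℕ :=
  Nat.card (Quotient (medialQuasigroupSetoid.{u, v} G))

open Matrix

/-! The operation Ax + By + c with invertible A, B is medial exactly when AB = BA, and every
isomorphism between two such quasigroups is an affine map (`equivalent_of_mulEquiv`). So the task is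
to count the orbits of triples (A, B, c) under the affine group of the plane.

The commutant of a nonscalar A is F[A]; hence a commuting pair is conjugate to two scalars, to a
scalar and a companion matrix, or to a companion matrix and a polynomial in it. Put w = 1 - A - B.
Translations move c by the range of w, so a constant in that range becomes 0. If w is singular, a
constant outside the range can be made the first vector of a basis adapted to the pair, that is
`![1, 0]`. The only exception is w = 0 with A nonscalar and c an eigenvector of A; there the
eigenvalue of c and the other eigenvalue of A, both different from 0 and 1, classify the triple.

`AffineDatum.exists_equivalent` and `NormalParam.eq_of_equivalent` make this a classification. With
q elements in the field, there are q^4 - q^3 + q^2 - 3q + 2 classes of pairs (`natCard_pairParam`),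
q^3 - 3q^2 + 6q - 7 of them with w singular (`natCard_singular`), and (q - 2)^2 exceptional triples;
the sum is the claim. -/

namespace MedialCount

/-! ### Linear algebra of the plane: cyclic vectors and eigenvectors. -/

section Algebra

variable {F : Type*} [Field F]

/-- The determinant of a pair of vectors in the plane. -/
def det₂ (v w : Fin 2 → F) : F := v 0 * w 1 - v 1 * w 0

/-- The matrix with columns `v` and `w`. -/
def cols (v w : Fin 2 → F) : Matrix (Fin 2) (Fin 2) F := !![v 0, w 0; v 1, w 1]

theorem det_cols (v w : Fin 2 → F) : (cols v w).det = det₂ v w := by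
  simp [cols, det₂, Matrix.det_fin_two]; ring

theorem mul_cols (A : Matrix (Fin 2) (Fin 2) F) (v w : Fin 2 → F) :
    A * cols v w = cols (A *ᵥ v) (A *ᵥ w) := by
  ext i j
  fin_cases i <;> fin_cases j <;> simp [cols, Matrix.mul_apply, Matrix.mulVec, dotProduct]

theorem cols_mul (v w : Fin 2 → F) (a b c d : F) :
    cols v w * !![a, b; c, d] = cols (a • v + c • w) (b • v + d • w) := by
  ext i j
  fin_cases i <;> fin_cases j <;> simp [cols] <;> ring

theorem cols_mulVec (v w : Fin 2 → F) : cols v w *ᵥ ![1, 0] = v := by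
  ext i
  fin_cases i <;> simp [cols, Matrix.mulVec, dotProduct]

theorem exists_eq_smul_of_det₂_eq_zero {v w : Fin 2 → F} (hv : v ≠ 0) (h : det₂ v w = 0) :
    ∃ k : F, w = k • v := by
  unfold det₂ at h
  by_cases h0 : v 0 = 0
  · have h1 : v 1 ≠ 0 := by
      intro h1
      apply hv
      ext i
      fin_cases i <;> simp [h0, h1]
    refine ⟨w 1 / v 1, ?_⟩
    have : w 0 = 0 := by simpa [h0, h1] using h
    ext i
    fin_cases i <;> simp [h0, h1, this]
  · refine ⟨w 0 / v 0, ?_⟩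
    ext i
    fin_cases i
    · simp [h0]
    · simp only [Fin.mk_one, Pi.smul_apply, smul_eq_mul]
      field_simp
      linear_combination h

theorem exists_eq_add_of_det₂_ne_zero {v w : Fin 2 → F} (h : det₂ v w ≠ 0) (x : Fin 2 → F) :
    ∃ a b : F, x = a • v + b • w := by
  refine ⟨det₂ x w / det₂ v w, det₂ v x / det₂ v w, ?_⟩
  ext i
  fin_cases i <;> simp only [Fin.zero_eta, Fin.mk_one, Pi.add_apply, Pi.smul_apply, smul_eq_mul] <;>
    field_simp <;> simp only [det₂] <;> ring

theorem exists_det₂_ne_zero {v : Fin 2 → F} (hv : v ≠ 0) : ∃ w, det₂ v w ≠ 0 := by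
  by_contra! h
  apply hv
  ext i
  fin_cases i
  · simpa [det₂] using h ![0, 1]
  · simpa [det₂] using h ![1, 0]

theorem eq_of_mulVec_eq {A B : Matrix (Fin 2) (Fin 2) F} {v w : Fin 2 → F} (h : det₂ v w ≠ 0)
    (hv : A *ᵥ v = B *ᵥ v) (hw : A *ᵥ w = B *ᵥ w) : A = B := by
  have hu : IsUnit (cols v w).det := by rw [det_cols]; exact h.isUnit
  have : A * cols v w = B * cols v w := by rw [mul_cols, mul_cols, hv, hw]
  exact ((Matrix.isUnit_iff_isUnit_det _).2 hu).mul_right_cancel this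

/-- The companion matrix of `X ^ 2 - t X + d`. -/
def companion (t d : F) : Matrix (Fin 2) (Fin 2) F := !![0, -d; 1, t]

/-- Cayley-Hamilton, applied to v; no cyclicity of v is needed. -/
theorem mul_cols_eq_companion (A : Matrix (Fin 2) (Fin 2) F) (v : Fin 2 → F) :
    A * cols v (A *ᵥ v) = cols v (A *ᵥ v) * companion A.trace A.det := by
  ext i j
  fin_cases i <;> fin_cases j <;>
    simp [cols, companion, Matrix.mul_apply, Matrix.mulVec, dotProduct, Matrix.det_fin_two,
      Matrix.trace_fin_two] <;> ring

theorem exists_cyclic {A : Matrix (Fin 2) (Fin 2) F} (hA : ∀ a : F, A ≠ a • 1) :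
    ∃ v, det₂ v (A *ᵥ v) ≠ 0 := by
  by_contra! h
  -- If both basis vectors and their sum are eigenvectors, the off-diagonal entries vanish and the
  -- diagonal ones agree.
  have h1 := h ![1, 0]
  have h2 := h ![0, 1]
  have h3 := h ![1, 1]
  simp [det₂, Matrix.mulVec, dotProduct] at h1 h2 h3
  apply hA (A 0 0)
  ext i j
  fin_cases i <;> fin_cases j <;> simp [h1, h2]
  linear_combination h3 - h1 + h2

/-- Matrices commuting with A are determined by their value at the cyclic vector x, and F[A] already
realises every value. -/
theorem exists_eq_smul_add_of_commute {A B : Matrix (Fin 2) (Fin 2) F} (h : A * B = B * A)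
    {x : Fin 2 → F} (hx : det₂ x (A *ᵥ x) ≠ 0) : ∃ u v : F, B = v • 1 + u • A := by
  obtain ⟨v, u, e⟩ := exists_eq_add_of_det₂_ne_zero hx (B *ᵥ x)
  refine ⟨u, v, eq_of_mulVec_eq hx ?_ ?_⟩
  · rw [e]
    simp [Matrix.add_mulVec, Matrix.smul_mulVec]
  · rw [Matrix.mulVec_mulVec, ← h, ← Matrix.mulVec_mulVec, e, Matrix.mulVec_add,
      Matrix.mulVec_smul, Matrix.mulVec_smul, Matrix.add_mulVec, Matrix.smul_mulVec,
      Matrix.smul_mulVec, Matrix.one_mulVec]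

/-- A coset of the range of a singular element `w` of `F[A]`, other than the range itself, holds a
cyclic vector for `A`. -/
theorem exists_cyclic_add {A w : Matrix (Fin 2) (Fin 2) F} (hA : ∀ a : F, A ≠ a • 1)
    (hc : A * w = w * A) (hw0 : w ≠ 0) (hw : w.det = 0) {c : Fin 2 → F}
    (hcw : ∀ z, c ≠ w *ᵥ z) : ∃ z, det₂ (c + w *ᵥ z) (A *ᵥ (c + w *ᵥ z)) ≠ 0 := by
  by_cases h : det₂ c (A *ᵥ c) ≠ 0
  · exact ⟨0, by simpa using h⟩
  push Not at h
  have hc0 : c ≠ 0 := by simpa using hcw 0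
  obtain ⟨l, hl⟩ := exists_eq_smul_of_det₂_eq_zero hc0 h
  obtain ⟨z, hz⟩ : ∃ z, w *ᵥ z ≠ 0 := by
    by_contra! h'
    apply hw0
    apply Matrix.ext_of_mulVec_single
    intro i
    rw [h', Matrix.zero_mulVec]
  have hind : det₂ (w *ᵥ z) c ≠ 0 := by
    intro h'
    obtain ⟨k, hk⟩ := exists_eq_smul_of_det₂_eq_zero hz h'
    exact hcw (k • z) (by rw [hk, Matrix.mulVec_smul])
  -- The range of w is an A-stable line. If c is an eigenvector too, the two eigenvalues differ, as
  -- A is not scalar, and a sum of eigenvectors for distinct eigenvalues is cyclic.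
  have hdet : det₂ (w *ᵥ z) (A *ᵥ w *ᵥ z) = 0 := by
    rw [Matrix.mulVec_mulVec, hc, ← Matrix.mulVec_mulVec, ← det_cols, ← mul_cols, Matrix.det_mul,
      hw, zero_mul]
  obtain ⟨k, hk⟩ := exists_eq_smul_of_det₂_eq_zero hz hdet
  have hkl : k ≠ l := by
    rintro rfl
    refine hA k (eq_of_mulVec_eq hind ?_ ?_)
    · rw [hk]; simp [Matrix.smul_mulVec]
    · rw [hl]; simp [Matrix.smul_mulVec]
  refine ⟨z, ?_⟩
  rw [Matrix.mulVec_add, hl, hk]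
  have : det₂ (c + w *ᵥ z) (l • c + k • w *ᵥ z) = (l - k) * det₂ (w *ᵥ z) c := by
    simp only [det₂, Pi.add_apply, Pi.smul_apply, smul_eq_mul]; ring
  rw [this]
  exact mul_ne_zero (sub_ne_zero.2 hkl.symm) hind

/-- The off-diagonal entry can be normalised to 1 even for a diagonalisable A: add c to a second
eigenvector w and rescale. This gives one normal form for l = m and l ≠ m. -/
theorem exists_jordan_vector {A : Matrix (Fin 2) (Fin 2) F} (hA : ∀ a : F, A ≠ a • 1)
    {c : Fin 2 → F} (hc : c ≠ 0) {l : F} (hl : A *ᵥ c = l • c) :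
    ∃ (v : Fin 2 → F) (m : F), det₂ c v ≠ 0 ∧ A *ᵥ v = c + m • v := by
  obtain ⟨w, hw⟩ := exists_det₂_ne_zero hc
  obtain ⟨x, m, e⟩ := exists_eq_add_of_det₂_ne_zero hw (A *ᵥ w)
  by_cases hx : x = 0
  · have hlm : l - m ≠ 0 := by
      intro h
      obtain rfl := sub_eq_zero.1 h
      refine hA l (eq_of_mulVec_eq hw ?_ ?_)
      · rw [hl]; simp [Matrix.smul_mulVec]
      · rw [e, hx]; simp [Matrix.smul_mulVec]
    refine ⟨(l - m)⁻¹ • (w + c), m, ?_, ?_⟩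
    · have : det₂ c ((l - m)⁻¹ • (w + c)) = (l - m)⁻¹ * det₂ c w := by
        simp only [det₂, Pi.add_apply, Pi.smul_apply, smul_eq_mul]; ring
      rw [this]
      exact mul_ne_zero (inv_ne_zero hlm) hw
    · rw [Matrix.mulVec_smul, Matrix.mulVec_add, e, hl, hx]
      ext i
      simp only [Pi.add_apply, Pi.smul_apply, smul_eq_mul]
      field_simp
      ring
  · refine ⟨x⁻¹ • w, m, ?_, ?_⟩
    · have : det₂ c (x⁻¹ • w) = x⁻¹ * det₂ c w := by
        simp only [det₂, Pi.smul_apply, smul_eq_mul]; ring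
      rw [this]
      exact mul_ne_zero (inv_ne_zero hx) hw
    · rw [Matrix.mulVec_smul, e]
      ext i
      simp only [Pi.add_apply, Pi.smul_apply, smul_eq_mul]
      field_simp

end Algebra

/-! ### Data, their equivalence and the normal forms. -/

section Normal

variable (F : Type*) [Field F]

/-- A commuting pair of invertible matrices together with a vector: the data of a medial quasigroup
in affine form over the plane. -/
structure AffineDatum where
  /-- the left coefficient -/
  A : Matrix (Fin 2) (Fin 2) F
  /-- the right coefficient -/
  B : Matrix (Fin 2) (Fin 2) F
  /-- the constant -/
  c : Fin 2 → F
  det_A : A.det ≠ 0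
  det_B : B.det ≠ 0
  comm : A * B = B * A

/-- Parameters of the conjugacy classes of commuting pairs of invertible matrices: two scalars; a
scalar and a companion matrix; a companion matrix and a polynomial in it. -/
abbrev PairParam :=
  {x : F × F // x.1 ≠ 0 ∧ x.2 ≠ 0} ⊕
  {x : F × F × F // x.1 ≠ 0 ∧ x.2.2 ≠ 0} ⊕
  {x : F × F × F × F //
    x.2.1 ≠ 0 ∧ x.2.2.2 ^ 2 + x.2.2.1 * x.2.2.2 * x.1 + x.2.2.1 ^ 2 * x.2.1 ≠ 0}

variable {F}

/-- The affine equivalence of data, that is, isomorphism of the quasigroups. -/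
def AffineDatum.Equivalent (D E : AffineDatum F) : Prop :=
  ∃ (P : Matrix (Fin 2) (Fin 2) F) (d : Fin 2 → F), P.det ≠ 0 ∧ P * D.A = E.A * P ∧
    P * D.B = E.B * P ∧ P *ᵥ D.c + d = E.A *ᵥ d + E.B *ᵥ d + E.c

/-- The left matrix of the pair with the given parameters. -/
def PairParam.A : PairParam F → Matrix (Fin 2) (Fin 2) F
  | .inl x => x.1.1 • 1
  | .inr (.inl x) => x.1.1 • 1
  | .inr (.inr x) => companion x.1.1 x.1.2.1

/-- The right matrix of the pair with the given parameters. -/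
def PairParam.B : PairParam F → Matrix (Fin 2) (Fin 2) F
  | .inl x => x.1.2 • 1
  | .inr (.inl x) => companion x.1.2.1 x.1.2.2
  | .inr (.inr x) => x.1.2.2.2 • 1 + x.1.2.2.1 • companion x.1.1 x.1.2.1

theorem det_companion (t d : F) : (companion t d).det = d := by
  simp [companion, Matrix.det_fin_two]

theorem trace_companion (t d : F) : (companion t d).trace = t := by
  simp [companion, Matrix.trace_fin_two]

theorem det_smul_add_companion (t d u v : F) :
    (v • 1 + u • companion t d).det = v ^ 2 + u * v * t + u ^ 2 * d := by
  simp [companion, Matrix.det_fin_two]; ring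

theorem companion_ne_smul (t d a : F) : companion t d ≠ a • 1 := by
  intro h
  simpa [companion] using congrFun (congrFun h 1) 0

theorem PairParam.det_A (b : PairParam F) : (PairParam.A b).det ≠ 0 := by
  rcases b with ⟨x, h1, h2⟩ | ⟨x, h1, h2⟩ | ⟨x, h1, h2⟩
  · simpa [PairParam.A, Matrix.det_fin_two] using h1
  · simpa [PairParam.A, Matrix.det_fin_two] using h1
  · simpa [PairParam.A, det_companion] using h1

theorem PairParam.det_B (b : PairParam F) : (PairParam.B b).det ≠ 0 := by
  rcases b with ⟨x, h1, h2⟩ | ⟨x, h1, h2⟩ | ⟨x, h1, h2⟩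
  · simpa [PairParam.B, Matrix.det_fin_two] using h2
  · simpa [PairParam.B, det_companion] using h2
  · simpa [PairParam.B, det_smul_add_companion] using h2

theorem PairParam.comm (b : PairParam F) :
    PairParam.A b * PairParam.B b = PairParam.B b * PairParam.A b := by
  rcases b with x | x | x <;> simp [PairParam.A, PairParam.B, mul_add, add_mul]
  exact smul_comm _ _ _

/-- The datum with the pair of the given parameters and the constant `c`. -/
def PairParam.datum (b : PairParam F) (c : Fin 2 → F) : AffineDatum F :=
  ⟨PairParam.A b, PairParam.B b, c, b.det_A, b.det_B, b.comm⟩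

/-- The difference `1 - A - B`, whose range consists of the constants that can be removed. -/
def PairParam.defect (b : PairParam F) : Matrix (Fin 2) (Fin 2) F :=
  1 - PairParam.A b - PairParam.B b

variable (F) in
/-- Parameters of the eigenvalues of `A` in the data with `A + B = 1` and a constant that is an
eigenvector of the nonscalar matrix `A`. -/
abbrev EigenParam := {x : F // x ≠ 0 ∧ x ≠ 1} × {x : F // x ≠ 0 ∧ x ≠ 1}

/-- The data with `A + B = 1` and a constant that is an eigenvector of the nonscalar matrix `A`. -/
def EigenParam.datum (x : EigenParam F) : AffineDatum F where
  A := !![x.1.1, 1; 0, x.2.1]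
  B := 1 - !![x.1.1, 1; 0, x.2.1]
  c := ![1, 0]
  det_A := by simp [Matrix.det_fin_two, x.1.2.1, x.2.2.1]
  det_B := by
    simp [Matrix.det_fin_two, sub_eq_zero, x.1.2.2.symm, x.2.2.2.symm]
  comm := by simp [mul_sub, sub_mul]

variable (F) in
/-- Parameters of the classes of data. -/
abbrev NormalParam :=
  PairParam F ⊕ {b : PairParam F // b.defect.det = 0} ⊕ EigenParam F

/-- The normal forms of data. -/
def NormalParam.datum : NormalParam F → AffineDatum F
  | .inl b => b.datum 0
  | .inr (.inl b) => b.1.datum ![1, 0]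
  | .inr (.inr x) => EigenParam.datum x

/-- A singular matrix with `![1, 0]` in its range has zero bottom row. The defect is a scalar or a
polynomial of degree at most 1 in a companion matrix, so a zero bottom row makes it 0, which is
absurd. -/
theorem PairParam.not_mem_range_defect (b : PairParam F) (hb : b.defect.det = 0)
    (z : Fin 2 → F) : b.defect *ᵥ z ≠ ![1, 0] := by
  intro h
  have key : b.defect 1 1 = 0 ∧ b.defect 1 0 = 0 := by
    have h0 := congrFun h 0
    have h1 := congrFun h 1
    rw [Matrix.det_fin_two] at hb
    simp [Matrix.mulVec, dotProduct] at h0 h1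
    constructor
    · linear_combination b.defect 0 1 * h1 - b.defect 1 1 * h0 + z 0 * hb
    · linear_combination b.defect 0 0 * h1 - b.defect 1 0 * h0 - z 1 * hb
  have h0 := congrFun h 0
  simp only [Matrix.mulVec, dotProduct, Fin.sum_univ_two, Matrix.cons_val_zero] at h0
  rcases b with x | x | x <;>
    simp [PairParam.defect, PairParam.A, PairParam.B, companion] at key h0
  · simp [key] at h0
  · obtain ⟨k1, k2⟩ := key
    have : (1 : F) - x.1.2.2.2 = 0 := by linear_combination k1 - x.1.1 * k2
    have e : x.1.2.2.1 = -1 := by linear_combination -k2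
    simp [this, e] at h0

end Normal

/-! ### Every datum has exactly one normal form. -/

section Classification

variable {F : Type*} [Field F]

theorem mulVec_bijective_of_det_ne_zero {P : Matrix (Fin 2) (Fin 2) F} (hP : P.det ≠ 0) :
    Function.Bijective P.mulVec :=
  have hu := (Matrix.isUnit_iff_isUnit_det P).2 hP.isUnit
  ⟨Matrix.mulVec_injective_iff_isUnit.2 hu, Matrix.mulVec_surjective_iff_isUnit.2 hu⟩

/-- The pair of matrices of `D` is put into normal form by a basis whose first vector is `x`. -/
def AffineDatum.Adapted (D : AffineDatum F) (x : Fin 2 → F) : Prop :=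
  ∃ (b : PairParam F) (P : Matrix (Fin 2) (Fin 2) F), P.det ≠ 0 ∧
    P * PairParam.A b = D.A * P ∧ P * PairParam.B b = D.B * P ∧ P *ᵥ ![1, 0] = x

theorem AffineDatum.adapted_of_cyclic_A (D : AffineDatum F) {x : Fin 2 → F}
    (hx : det₂ x (D.A *ᵥ x) ≠ 0) : D.Adapted x := by
  obtain ⟨u, v, hB⟩ := exists_eq_smul_add_of_commute D.comm hx
  have hP : (cols x (D.A *ᵥ x)).det ≠ 0 := by rwa [det_cols]
  have hA := mul_cols_eq_companion D.A x
  have hB' : cols x (D.A *ᵥ x) * (v • 1 + u • companion D.A.trace D.A.det) =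
      D.B * cols x (D.A *ᵥ x) := by
    rw [hB, mul_add, add_mul, mul_smul_comm, mul_smul_comm, smul_mul_assoc, smul_mul_assoc, hA,
      mul_one, one_mul]
  -- The polynomial in the companion matrix is conjugate to `D.B`, hence invertible, as the
  -- parameters require.
  have hdet : (v • 1 + u • companion D.A.trace D.A.det).det ≠ 0 := by
    intro h
    have := congrArg Matrix.det hB'
    rw [Matrix.det_mul, Matrix.det_mul, h, mul_zero] at this
    exact mul_ne_zero D.det_B hP this.symm
  rw [det_smul_add_companion] at hdet
  exact ⟨.inr (.inr ⟨(D.A.trace, D.A.det, u, v), D.det_A, hdet⟩), _, hP, hA.symm, hB',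
    cols_mulVec _ _⟩

theorem AffineDatum.adapted_of_cyclic_B (D : AffineDatum F) {a : F} (ha : D.A = a • 1)
    {x : Fin 2 → F} (hx : det₂ x (D.B *ᵥ x) ≠ 0) : D.Adapted x := by
  have hP : (cols x (D.B *ᵥ x)).det ≠ 0 := by rwa [det_cols]
  have ha0 : a ≠ 0 := by
    rintro rfl
    exact D.det_A (by simp [ha])
  refine ⟨.inr (.inl ⟨(a, D.B.trace, D.B.det), ha0, D.det_B⟩), _, hP, ?_,
    (mul_cols_eq_companion D.B x).symm, cols_mulVec _ _⟩
  rw [ha]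
  simp [PairParam.A]

theorem AffineDatum.adapted_of_scalar (D : AffineDatum F) {a b : F} (ha : D.A = a • 1)
    (hb : D.B = b • 1) {x : Fin 2 → F} (hx : x ≠ 0) : D.Adapted x := by
  obtain ⟨w, hw⟩ := exists_det₂_ne_zero hx
  have ha0 : a ≠ 0 := by
    rintro rfl
    exact D.det_A (by simp [ha])
  have hb0 : b ≠ 0 := by
    rintro rfl
    exact D.det_B (by simp [hb])
  refine ⟨.inl ⟨(a, b), ha0, hb0⟩, cols x w, by rwa [det_cols], ?_, ?_, cols_mulVec _ _⟩
  · rw [ha]; simp [PairParam.A]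
  · rw [hb]; simp [PairParam.B]

theorem AffineDatum.exists_adapted (D : AffineDatum F) : ∃ x, D.Adapted x := by
  by_cases hA : ∀ a : F, D.A ≠ a • 1
  · obtain ⟨x, hx⟩ := exists_cyclic hA
    exact ⟨x, D.adapted_of_cyclic_A hx⟩
  push Not at hA
  obtain ⟨a, ha⟩ := hA
  by_cases hB : ∀ a : F, D.B ≠ a • 1
  · obtain ⟨x, hx⟩ := exists_cyclic hB
    exact ⟨x, D.adapted_of_cyclic_B ha hx⟩
  push Not at hB
  obtain ⟨b, hb⟩ := hB
  exact ⟨![1, 0], D.adapted_of_scalar ha hb (by simp)⟩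

theorem AffineDatum.equivalent_of_sub_mulVec (D : AffineDatum F) {z : Fin 2 → F}
    (hz : D.c = (1 - D.A - D.B) *ᵥ z) : ∃ s : NormalParam F, s.datum.Equivalent D := by
  obtain ⟨x, b, P, hP, hA, hB, -⟩ := D.exists_adapted
  refine ⟨.inl b, P, z, hP, hA, hB, ?_⟩
  rw [hz, Matrix.sub_mulVec, Matrix.sub_mulVec, Matrix.one_mulVec]
  change P *ᵥ 0 + z = _
  rw [Matrix.mulVec_zero]
  abel

/-- Translation by -z turns the constant into the first vector of the adapted basis. -/
theorem AffineDatum.Adapted.exists_equivalent {D : AffineDatum F} {z : Fin 2 → F}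
    (h : D.Adapted (D.c + (1 - D.A - D.B) *ᵥ z)) (hw : (1 - D.A - D.B).det = 0) :
    ∃ s : NormalParam F, s.datum.Equivalent D := by
  obtain ⟨b, P, hP, hA, hB, hx⟩ := h
  have hd : b.defect.det = 0 := by
    have : P * b.defect = (1 - D.A - D.B) * P := by
      simp only [PairParam.defect, mul_sub, sub_mul, hA, hB, mul_one, one_mul]
    have := congrArg Matrix.det this
    rw [Matrix.det_mul, Matrix.det_mul, hw, zero_mul] at this
    exact (mul_eq_zero.1 this).resolve_left hP
  refine ⟨.inr (.inl ⟨b, hd⟩), P, -z, hP, hA, hB, ?_⟩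
  change P *ᵥ ![1, 0] + -z = _
  rw [hx, Matrix.sub_mulVec, Matrix.sub_mulVec, Matrix.one_mulVec, Matrix.mulVec_neg,
    Matrix.mulVec_neg]
  abel

/-- As A + B = 1, translations do not move c, so it cannot be replaced by a cyclic vector; a
triangular basis starting at c serves instead. -/
theorem AffineDatum.exists_equivalent_of_eigenvector (D : AffineDatum F)
    (hA : ∀ a : F, D.A ≠ a • 1) (hw : 1 - D.A - D.B = 0) (hc : D.c ≠ 0)
    (h : det₂ D.c (D.A *ᵥ D.c) = 0) : ∃ s : NormalParam F, s.datum.Equivalent D := by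
  obtain ⟨l, hl⟩ := exists_eq_smul_of_det₂_eq_zero hc h
  obtain ⟨v, m, hv, hm⟩ := exists_jordan_vector hA hc hl
  have hB : D.B = 1 - D.A := (sub_eq_zero.1 hw).symm
  have hP : (cols D.c v).det ≠ 0 := by rwa [det_cols]
  have hAP : cols D.c v * !![l, 1; 0, m] = D.A * cols D.c v := by
    rw [cols_mul, mul_cols, hl, hm]
    simp
  have hBP : cols D.c v * (1 - !![l, 1; 0, m]) = D.B * cols D.c v := by
    rw [mul_sub, hAP, hB, sub_mul, mul_one, one_mul]
  have h1 := congrArg Matrix.det hAP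
  have h2 := congrArg Matrix.det hBP
  rw [Matrix.det_mul, Matrix.det_mul, mul_comm] at h1 h2
  have h1' : (!![l, 1; 0, m] : Matrix (Fin 2) (Fin 2) F).det ≠ 0 :=
    mul_right_cancel₀ hP h1 ▸ D.det_A
  have h2' : (1 - !![l, 1; 0, m] : Matrix (Fin 2) (Fin 2) F).det ≠ 0 :=
    mul_right_cancel₀ hP h2 ▸ D.det_B
  simp [Matrix.det_fin_two, sub_eq_zero] at h1' h2'
  refine ⟨.inr (.inr (⟨l, h1'.1, Ne.symm h2'.1⟩, ⟨m, h1'.2, Ne.symm h2'.2⟩)), cols D.c v, 0, hP,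
    hAP, hBP, ?_⟩
  change cols D.c v *ᵥ ![1, 0] + 0 = _
  rw [cols_mulVec, add_zero, Matrix.mulVec_zero, Matrix.mulVec_zero, add_zero, zero_add]

theorem AffineDatum.exists_equivalent (D : AffineDatum F) :
    ∃ s : NormalParam F, s.datum.Equivalent D := by
  by_cases hz : ∃ z, D.c = (1 - D.A - D.B) *ᵥ z
  · obtain ⟨z, hz⟩ := hz
    exact D.equivalent_of_sub_mulVec hz
  push Not at hz
  have hw : (1 - D.A - D.B).det = 0 := by
    by_contra h
    obtain ⟨z, h⟩ := (mulVec_bijective_of_det_ne_zero h).2 D.c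
    exact hz z h.symm
  have hc : D.c ≠ 0 := by simpa using hz 0
  by_cases hA : ∀ a : F, D.A ≠ a • 1
  · by_cases hw0 : 1 - D.A - D.B = 0
    · by_cases h : det₂ D.c (D.A *ᵥ D.c) = 0
      · exact D.exists_equivalent_of_eigenvector hA hw0 hc h
      · exact AffineDatum.Adapted.exists_equivalent (z := 0)
          (by simpa using D.adapted_of_cyclic_A h) hw
    · obtain ⟨z, h⟩ := exists_cyclic_add hA
        (by simp only [mul_sub, sub_mul, mul_one, one_mul, D.comm]) hw0 hw hz
      exact (D.adapted_of_cyclic_A h).exists_equivalent hw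
  push Not at hA
  obtain ⟨a, ha⟩ := hA
  by_cases hB : ∀ a : F, D.B ≠ a • 1
  · have hw0 : 1 - D.A - D.B ≠ 0 := by
      intro h
      apply hB (1 - a)
      rw [← sub_eq_zero.1 h, ha, sub_smul, one_smul]
    obtain ⟨z, h⟩ := exists_cyclic_add hB
      (by simp only [mul_sub, sub_mul, mul_one, one_mul, D.comm]) hw0 hw hz
    exact (D.adapted_of_cyclic_B ha h).exists_equivalent hw
  push Not at hB
  obtain ⟨b, hb⟩ := hB
  exact AffineDatum.Adapted.exists_equivalent (z := 0)
    (by simpa using D.adapted_of_scalar ha hb hc) hw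

theorem eq_smul_of_mul_smul_eq {P A : Matrix (Fin 2) (Fin 2) F} (hP : P.det ≠ 0) {a : F}
    (h : P * (a • 1) = A * P) : A = a • 1 := by
  refine ((Matrix.isUnit_iff_isUnit_det P).2 hP.isUnit).mul_right_cancel ?_
  rw [← h]
  simp

theorem smul_one_injective {a b : F}
    (h : (a • 1 : Matrix (Fin 2) (Fin 2) F) = b • 1) : a = b := by
  simpa using congrFun (congrFun h 0) 0

theorem eq_smul_of_smul_mul_eq {P A : Matrix (Fin 2) (Fin 2) F} (hP : P.det ≠ 0) {a : F}
    (h : P * A = (a • 1) * P) : A = a • 1 := by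
  refine ((Matrix.isUnit_iff_isUnit_det P).2 hP.isUnit).mul_left_cancel ?_
  rw [h]
  simp

theorem det_eq_of_mul_eq_mul {P A B : Matrix (Fin 2) (Fin 2) F} (hP : P.det ≠ 0)
    (h : P * A = B * P) : A.det = B.det := by
  have := congrArg Matrix.det h
  rw [Matrix.det_mul, Matrix.det_mul, mul_comm] at this
  exact mul_right_cancel₀ hP this

theorem trace_eq_of_mul_eq_mul {P A B : Matrix (Fin 2) (Fin 2) F} (hP : P.det ≠ 0)
    (h : P * A = B * P) : A.trace = B.trace := by
  have hu : IsUnit P.det := hP.isUnit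
  have : A = P⁻¹ * (B * P) := by
    rw [← h, ← mul_assoc, Matrix.nonsing_inv_mul _ hu, one_mul]
  rw [this, Matrix.trace_mul_comm, mul_assoc, Matrix.mul_nonsing_inv _ hu, mul_one]

theorem companion_eq_of_mul_eq_mul {P : Matrix (Fin 2) (Fin 2) F} (hP : P.det ≠ 0)
    {t d t' d' : F} (h : P * companion t d = companion t' d' * P) : t = t' ∧ d = d' := by
  have h1 := trace_eq_of_mul_eq_mul hP h
  have h2 := det_eq_of_mul_eq_mul hP h
  rw [trace_companion, trace_companion] at h1
  rw [det_companion, det_companion] at h2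
  exact ⟨h1, h2⟩

theorem PairParam.eq_of_mul_eq_mul {b b' : PairParam F} {P : Matrix (Fin 2) (Fin 2) F}
    (hP : P.det ≠ 0) (hA : P * PairParam.A b = PairParam.A b' * P)
    (hB : P * PairParam.B b = PairParam.B b' * P) : b = b' := by
  rcases b with ⟨⟨a, c⟩, h⟩ | ⟨⟨a, t, d⟩, h⟩ | ⟨⟨t, d, u, v⟩, h⟩ <;>
    rcases b' with ⟨⟨a', c'⟩, h'⟩ | ⟨⟨a', t', d'⟩, h'⟩ | ⟨⟨t', d', u', v'⟩, h'⟩ <;>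
    simp only [PairParam.A, PairParam.B] at hA hB
  · obtain rfl := smul_one_injective (eq_smul_of_mul_smul_eq hP hA)
    obtain rfl := smul_one_injective (eq_smul_of_mul_smul_eq hP hB)
    rfl
  · exact absurd (eq_smul_of_mul_smul_eq hP hB) (companion_ne_smul _ _ _)
  · exact absurd (eq_smul_of_mul_smul_eq hP hA) (companion_ne_smul _ _ _)
  · exact absurd (eq_smul_of_smul_mul_eq hP hB) (companion_ne_smul _ _ _)
  · obtain rfl := smul_one_injective (eq_smul_of_mul_smul_eq hP hA)
    obtain ⟨rfl, rfl⟩ := companion_eq_of_mul_eq_mul hP hB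
    rfl
  · exact absurd (eq_smul_of_mul_smul_eq hP hA) (companion_ne_smul _ _ _)
  · exact absurd (eq_smul_of_smul_mul_eq hP hA) (companion_ne_smul _ _ _)
  · exact absurd (eq_smul_of_smul_mul_eq hP hA) (companion_ne_smul _ _ _)
  · obtain ⟨rfl, rfl⟩ := companion_eq_of_mul_eq_mul hP hA
    -- `P` now commutes with the companion matrix, so it cancels; the first column then gives u and
    -- v.
    have key : v • 1 + u • companion t d = v' • 1 + u' • companion t d := by
      refine ((Matrix.isUnit_iff_isUnit_det P).2 hP.isUnit).mul_right_cancel ?_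
      rw [← hB, mul_add, add_mul, mul_smul_comm, mul_smul_comm, smul_mul_assoc, smul_mul_assoc,
        hA, mul_one, one_mul]
    have h0 := congrFun (congrFun key 0) 0
    have h1 := congrFun (congrFun key 1) 0
    simp [companion] at h0 h1
    subst h0 h1
    rfl

/-- The constant lies in the range of 1 - A - B exactly when the quasigroup has an idempotent; here
0 is one for `D`, and its image d would be one for `E`. -/
theorem not_equivalent_zero_of_range {D E : AffineDatum F} (hD : D.c = 0)
    (hE : ∀ z, (1 - E.A - E.B) *ᵥ z ≠ E.c) : ¬ D.Equivalent E := by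
  rintro ⟨P, d, -, -, -, h⟩
  apply hE d
  rw [hD, Matrix.mulVec_zero, zero_add] at h
  simp only [Matrix.sub_mulVec, Matrix.one_mulVec]
  nth_rewrite 1 [h]
  abel

theorem EigenParam.defect_datum (x : EigenParam F) :
    1 - (EigenParam.datum x).A - (EigenParam.datum x).B = 0 := by
  simp [EigenParam.datum]

theorem EigenParam.A_ne_smul (x : EigenParam F) (a : F) : (EigenParam.datum x).A ≠ a • 1 := by
  intro h
  simpa [EigenParam.datum] using congrFun (congrFun h 0) 1

theorem EigenParam.mulVec_c (x : EigenParam F) :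
    (EigenParam.datum x).A *ᵥ ![1, 0] = x.1.1 • ![1, 0] := by
  ext i; fin_cases i <;> simp [EigenParam.datum]

theorem EigenParam.mulVec_of_equivalent {D : AffineDatum F} {x : EigenParam F}
    {P : Matrix (Fin 2) (Fin 2) F} {d : Fin 2 → F}
    (h : P *ᵥ D.c + d = (EigenParam.datum x).A *ᵥ d + (EigenParam.datum x).B *ᵥ d +
      (EigenParam.datum x).c) : P *ᵥ D.c = ![1, 0] := by
  rw [← Matrix.add_mulVec] at h
  have : (EigenParam.datum x).A + (EigenParam.datum x).B = 1 := by simp [EigenParam.datum]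
  rw [this, Matrix.one_mulVec, add_comm] at h
  exact add_left_cancel h

/-- The conjugation must carry constant to constant, but `![1, 0]` is cyclic for a companion matrix
and an eigenvector on the other side. -/
theorem PairParam.not_equivalent_eigen (b : PairParam F) (x : EigenParam F) :
    ¬ (b.datum ![1, 0]).Equivalent (EigenParam.datum x) := by
  rintro ⟨P, d, hP, hA, -, h⟩
  replace h : P *ᵥ ![1, 0] = ![1, 0] := EigenParam.mulVec_of_equivalent h
  rcases b with y | y | y
  · exact EigenParam.A_ne_smul x _ (eq_smul_of_mul_smul_eq hP hA)
  · exact EigenParam.A_ne_smul x _ (eq_smul_of_mul_smul_eq hP hA)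
  · have h1 : P *ᵥ (companion y.1.1 y.1.2.1 *ᵥ ![1, 0]) = P *ᵥ (x.1.1 • ![1, 0]) := by
      replace hA : P * companion y.1.1 y.1.2.1 = (EigenParam.datum x).A * P := hA
      rw [Matrix.mulVec_smul, h, Matrix.mulVec_mulVec, hA, ← Matrix.mulVec_mulVec, h,
        EigenParam.mulVec_c]
    have := congrFun ((mulVec_bijective_of_det_ne_zero hP).1 h1) 1
    simp [companion] at this

theorem EigenParam.eq_of_equivalent {x y : EigenParam F}
    (h : (EigenParam.datum x).Equivalent (EigenParam.datum y)) : x = y := by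
  obtain ⟨P, d, hP, hA, -, h⟩ := h
  replace h : P *ᵥ ![1, 0] = ![1, 0] := EigenParam.mulVec_of_equivalent h
  have h1 : x.1.1 = y.1.1 := by
    have e : (P * (EigenParam.datum x).A) *ᵥ ![1, 0] = ((EigenParam.datum y).A * P) *ᵥ ![1, 0] := by
      rw [hA]
    rw [← Matrix.mulVec_mulVec, ← Matrix.mulVec_mulVec, h, EigenParam.mulVec_c,
      EigenParam.mulVec_c, Matrix.mulVec_smul, h] at e
    simpa using congrFun e 0
  have h2 := trace_eq_of_mul_eq_mul hP hA
  simp [EigenParam.datum, Matrix.trace_fin_two, h1] at h2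
  exact Prod.ext (Subtype.ext h1) (Subtype.ext h2)

theorem NormalParam.eq_of_equivalent {s s' : NormalParam F}
    (h : s.datum.Equivalent s'.datum) (h' : s'.datum.Equivalent s.datum) : s = s' := by
  have h12 (b : PairParam F) (b' : {b : PairParam F // b.defect.det = 0}) :
      ¬ (NormalParam.datum (.inl b)).Equivalent (NormalParam.datum (.inr (.inl b'))) :=
    not_equivalent_zero_of_range rfl (b'.1.not_mem_range_defect b'.2)
  have h13 (b : PairParam F) (x : EigenParam F) :
      ¬ (NormalParam.datum (.inl b)).Equivalent (NormalParam.datum (.inr (.inr x))) := by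
    refine not_equivalent_zero_of_range rfl fun z => ?_
    change (1 - (EigenParam.datum x).A - (EigenParam.datum x).B) *ᵥ z ≠ ![1, 0]
    rw [EigenParam.defect_datum, Matrix.zero_mulVec]
    intro h
    simpa using congrFun h 0
  have h23 (b : {b : PairParam F // b.defect.det = 0}) (x : EigenParam F) :
      ¬ (NormalParam.datum (.inr (.inl b))).Equivalent (NormalParam.datum (.inr (.inr x))) :=
    b.1.not_equivalent_eigen x
  rcases s with b | b | x <;> rcases s' with b' | b' | x'
  · obtain ⟨P, d, hP, hA, hB, -⟩ := h
    rw [PairParam.eq_of_mul_eq_mul hP hA hB]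
  · exact absurd h (h12 _ _)
  · exact absurd h (h13 _ _)
  · exact absurd h' (h12 _ _)
  · obtain ⟨P, d, hP, hA, hB, -⟩ := h
    rw [Subtype.ext (PairParam.eq_of_mul_eq_mul hP hA hB)]
  · exact absurd h (h23 _ _)
  · exact absurd h' (h13 _ _)
  · exact absurd h' (h23 _ _)
  · rw [EigenParam.eq_of_equivalent h]

end Classification

/-! ### From quasigroups to data and back. -/

section Quasigroup

/-- The medial quasigroup on the plane with the given datum. -/
def AffineDatum.quasigroup {F : Type} [Field F] (D : AffineDatum F) : MedialQuasigroup.{u} where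
  carrier := ULift.{u} (Fin 2 → F)
  mul := ⟨fun x y => ⟨D.A *ᵥ x.down + D.B *ᵥ y.down + D.c⟩⟩
  existsUnique_right a b := by
    obtain ⟨y, hy, hu⟩ := (mulVec_bijective_of_det_ne_zero D.det_B).existsUnique
      (b.down - D.c - D.A *ᵥ a.down)
    refine ⟨⟨y⟩, ULift.ext _ _ ?_, fun z hz => ULift.ext _ _ (hu _ ?_)⟩
    · change D.A *ᵥ a.down + D.B *ᵥ y + D.c = b.down
      rw [hy]
      abel
    · replace hz : D.A *ᵥ a.down + D.B *ᵥ z.down + D.c = b.down := congrArg ULift.down hz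
      rw [← hz]
      abel
  existsUnique_left a b := by
    obtain ⟨y, hy, hu⟩ := (mulVec_bijective_of_det_ne_zero D.det_A).existsUnique
      (b.down - D.c - D.B *ᵥ a.down)
    refine ⟨⟨y⟩, ULift.ext _ _ ?_, fun z hz => ULift.ext _ _ (hu _ ?_)⟩
    · change D.A *ᵥ y + D.B *ᵥ a.down + D.c = b.down
      rw [hy]
      abel
    · replace hz : D.A *ᵥ z.down + D.B *ᵥ a.down + D.c = b.down := congrArg ULift.down hz
      rw [← hz]
      abel
  medial x y s t := by
    apply ULift.ext
    change D.A *ᵥ (D.A *ᵥ x.down + D.B *ᵥ y.down + D.c) +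
        D.B *ᵥ (D.A *ᵥ s.down + D.B *ᵥ t.down + D.c) + D.c =
      D.A *ᵥ (D.A *ᵥ x.down + D.B *ᵥ s.down + D.c) +
        D.B *ᵥ (D.A *ᵥ y.down + D.B *ᵥ t.down + D.c) + D.c
    simp only [Matrix.mulVec_add, Matrix.mulVec_mulVec, D.comm]
    abel

theorem AffineDatum.Equivalent.nonempty_mulEquiv {F : Type} [Field F] {D E : AffineDatum F}
    (h : D.Equivalent E) :
    Nonempty (D.quasigroup.{u}.carrier ≃* E.quasigroup.{u}.carrier) := by
  obtain ⟨P, d, hP, hA, hB, hc⟩ := h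
  let f : D.quasigroup.{u}.carrier → E.quasigroup.{u}.carrier := fun x => ⟨P *ᵥ x.down + d⟩
  have hf : Function.Bijective f := by
    have hb := mulVec_bijective_of_det_ne_zero hP
    constructor
    · intro x y hxy
      exact ULift.ext _ _ (hb.1 (add_right_cancel (congrArg ULift.down hxy)))
    · intro y
      obtain ⟨x, hx⟩ := hb.2 (y.down - d)
      refine ⟨⟨x⟩, ULift.ext _ _ ?_⟩
      change P *ᵥ x + d = y.down
      rw [hx, sub_add_cancel]
  refine ⟨MulEquiv.mk (Equiv.ofBijective f hf) fun x y => ULift.ext _ _ ?_⟩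
  change P *ᵥ (D.A *ᵥ x.down + D.B *ᵥ y.down + D.c) + d =
    E.A *ᵥ (P *ᵥ x.down + d) + E.B *ᵥ (P *ᵥ y.down + d) + E.c
  rw [Matrix.mulVec_add, Matrix.mulVec_add, add_assoc, hc]
  simp only [Matrix.mulVec_add, Matrix.mulVec_mulVec, hA, hB]
  abel

/-- A map that is a sum of functions of the two summands of its argument is affine. -/
theorem map_add_of_map_add_eq_add {G H : Type*} [AddGroup G] [AddCommGroup H] {f α β : G → H}
    (h : ∀ x y, f (x + y) = α x + β y) (x y : G) : f (x + y) - f 0 = (f x - f 0) + (f y - f 0) := by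
  have h1 := h x 0
  have h2 := h 0 y
  have h3 := h 0 0
  rw [add_zero] at h1 h3
  rw [zero_add] at h2
  rw [h1, h2, h3, h]
  abel

variable {p : ℕ}

theorem exists_mulVec_eq (f : (Fin 2 → ZMod p) →+ (Fin 2 → ZMod p)) :
    ∃ P : Matrix (Fin 2) (Fin 2) (ZMod p), ∀ x, P *ᵥ x = f x :=
  ⟨LinearMap.toMatrix' (f.toZModLinearMap p), fun x => by simp [LinearMap.toMatrix'_mulVec]⟩

variable [Fact p.Prime]

theorem det_ne_zero_of_mulVec_injective {P : Matrix (Fin 2) (Fin 2) (ZMod p)}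
    (h : Function.Injective P.mulVec) : P.det ≠ 0 :=
  ((Matrix.isUnit_iff_isUnit_det P).1 (Matrix.mulVec_injective_iff_isUnit.1 h)).ne_zero

theorem equivalent_of_mulEquiv {D E : AffineDatum (ZMod p)}
    (e : D.quasigroup.{u}.carrier ≃* E.quasigroup.{u}.carrier) : D.Equivalent E := by
  let f : (Fin 2 → ZMod p) → (Fin 2 → ZMod p) := fun x => (e ⟨x⟩).down
  have hf (x y : Fin 2 → ZMod p) :
      f (D.A *ᵥ x + D.B *ᵥ y + D.c) = E.A *ᵥ f x + E.B *ᵥ f y + E.c :=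
    congrArg ULift.down (e.map_mul ⟨x⟩ ⟨y⟩)
  -- Since A and B are onto, x + y can be written as A a + B b + c with a depending only on x and b
  -- only on y; the homomorphism law then splits f.
  have hadd : ∀ x y, f (x + y) - f 0 = (f x - f 0) + (f y - f 0) := by
    choose a ha using (mulVec_bijective_of_det_ne_zero D.det_A).2
    choose b hb using (mulVec_bijective_of_det_ne_zero D.det_B).2
    apply map_add_of_map_add_eq_add (α := fun x => E.A *ᵥ f (a (x - D.c)))
      (β := fun y => E.B *ᵥ f (b y) + E.c)
    intro x y
    rw [← add_assoc, ← hf, ha, hb]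
    congr 1
    abel
  obtain ⟨P, hP⟩ := exists_mulVec_eq (AddMonoidHom.mk' (fun x => f x - f 0) hadd)
  replace hP (x : Fin 2 → ZMod p) : f x = P *ᵥ x + f 0 := by
    rw [hP]
    simp
  have hc : P *ᵥ D.c + f 0 = E.A *ᵥ f 0 + E.B *ᵥ f 0 + E.c := by
    rw [← hf, ← hP]
    simp
  refine ⟨P, f 0, det_ne_zero_of_mulVec_injective fun x y hxy => ?_, ?_, ?_, hc⟩
  · have : f x = f y := by rw [hP x, hP y, hxy]
    exact congrArg ULift.down (e.injective (ULift.ext _ _ this))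
  · refine Matrix.mulVec_injective (funext fun x => add_right_cancel (b := P *ᵥ D.c + f 0) ?_)
    have := hf x 0
    rw [hP (_ + _), hP x, Matrix.mulVec_zero, add_zero, Matrix.mulVec_add, Matrix.mulVec_add,
      Matrix.mulVec_mulVec, Matrix.mulVec_mulVec] at this
    rw [← add_assoc, this, hc]
    abel
  · refine Matrix.mulVec_injective (funext fun x => add_right_cancel (b := P *ᵥ D.c + f 0) ?_)
    have := hf 0 x
    rw [hP (_ + _), hP x, Matrix.mulVec_zero, zero_add, Matrix.mulVec_add, Matrix.mulVec_add,
      Matrix.mulVec_mulVec, Matrix.mulVec_mulVec] at this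
    rw [← add_assoc, this, hc]
    abel

theorem AffineDatum.admitsAffineForm (D : AffineDatum (ZMod p)) :
    D.quasigroup.{u}.AdmitsAffineForm (Fin 2 → ZMod p) :=
  ⟨AddEquiv.ofBijective (Matrix.mulVecLin D.A).toAddMonoidHom
      (mulVec_bijective_of_det_ne_zero D.det_A),
    AddEquiv.ofBijective (Matrix.mulVecLin D.B).toAddMonoidHom
      (mulVec_bijective_of_det_ne_zero D.det_B), D.c, Equiv.ulift, fun _ _ => rfl⟩

theorem exists_datum_mulEquiv {Q : MedialQuasigroup.{u}}
    (hQ : Q.AdmitsAffineForm (Fin 2 → ZMod p)) :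
    ∃ D : AffineDatum (ZMod p), Nonempty (D.quasigroup.{u}.carrier ≃* Q.carrier) := by
  obtain ⟨φ, ψ, c, e, he⟩ := hQ
  obtain ⟨A, hA⟩ := exists_mulVec_eq φ.toAddMonoidHom
  obtain ⟨B, hB⟩ := exists_mulVec_eq ψ.toAddMonoidHom
  replace hA (x : Fin 2 → ZMod p) : φ x = A *ᵥ x := (hA x).symm
  replace hB (x : Fin 2 → ZMod p) : ψ x = B *ᵥ x := (hB x).symm
  have hcomm : A * B = B * A := by
    refine Matrix.mulVec_injective (funext fun y => ?_)
    -- With zeros in the other three places, the medial law leaves ABy = BAy up to constants.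
    have := congrArg e (Q.medial (e.symm 0) (e.symm y) (e.symm 0) (e.symm 0))
    simp only [he, Equiv.apply_symm_apply, map_add, map_zero] at this
    simp only [hA, hB, zero_add, add_zero, Matrix.mulVec_mulVec] at this
    have h2 : (A * B) *ᵥ y + (A *ᵥ c + B *ᵥ c + c) = (B * A) *ᵥ y + (A *ᵥ c + B *ᵥ c + c) := by
      calc _ = (A * B) *ᵥ y + A *ᵥ c + B *ᵥ c + c := by abel
        _ = A *ᵥ c + ((B * A) *ᵥ y + B *ᵥ c) + c := this
        _ = _ := by abel
    exact add_right_cancel h2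
  refine ⟨⟨A, B, c, det_ne_zero_of_mulVec_injective fun x y hxy => φ.injective ?_,
    det_ne_zero_of_mulVec_injective fun x y hxy => ψ.injective ?_, hcomm⟩,
    ⟨MulEquiv.mk (Equiv.ulift.trans e.symm) fun x y => ?_⟩⟩
  · rw [hA, hA, hxy]
  · rw [hB, hB, hxy]
  · apply e.injective
    rw [he, hA, hB]
    change e (e.symm _) = A *ᵥ e (e.symm x.down) + B *ᵥ e (e.symm y.down) + c
    simp only [Equiv.apply_symm_apply]
    rfl

variable (p) in
theorem mq_eq_card_normalParam :
    mq.{u, 0} (Fin 2 → ZMod p) = Nat.card (NormalParam (ZMod p)) := by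
  let f : NormalParam (ZMod p) → Quotient (medialQuasigroupSetoid.{u, 0} (Fin 2 → ZMod p)) :=
    fun s => Quotient.mk _ ⟨s.datum.quasigroup, s.datum.admitsAffineForm⟩
  refine (Nat.card_eq_of_bijective f ⟨fun s s' h => ?_, fun q => ?_⟩).symm
  · obtain ⟨e⟩ : Nonempty (s.datum.quasigroup.carrier ≃* s'.datum.quasigroup.carrier) :=
      Quotient.exact h
    exact NormalParam.eq_of_equivalent (equivalent_of_mulEquiv e) (equivalent_of_mulEquiv e.symm)
  · induction q using Quotient.inductionOn with
    | h Q =>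
      obtain ⟨D, ⟨e⟩⟩ := exists_datum_mulEquiv Q.2
      obtain ⟨s, hs⟩ := D.exists_equivalent
      obtain ⟨e'⟩ := hs.nonempty_mulEquiv
      exact ⟨s, Quotient.sound ⟨e'.trans e⟩⟩

end Quasigroup

/-! ### Equations for the singular pairs. -/

section Defect

variable {F : Type*} [Field F]

theorem det_defect_inl (x : {x : F × F // x.1 ≠ 0 ∧ x.2 ≠ 0}) :
    (PairParam.defect (.inl x)).det = 0 ↔ x.1.1 + x.1.2 = 1 := by
  have : (PairParam.defect (.inl x)).det = (1 - (x.1.1 + x.1.2)) ^ 2 := by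
    simp [PairParam.defect, PairParam.A, PairParam.B, Matrix.det_fin_two]
    ring
  rw [this, sq_eq_zero_iff, sub_eq_zero, eq_comm]

theorem det_defect_inr_inl (x : {x : F × F × F // x.1 ≠ 0 ∧ x.2.2 ≠ 0}) :
    (PairParam.defect (.inr (.inl x))).det =
      (1 - x.1.1) ^ 2 - (1 - x.1.1) * x.1.2.1 + x.1.2.2 := by
  simp [PairParam.defect, PairParam.A, PairParam.B, companion, Matrix.det_fin_two]
  ring

theorem det_defect_inr_inr (x : {x : F × F × F × F //
    x.2.1 ≠ 0 ∧ x.2.2.2 ^ 2 + x.2.2.1 * x.2.2.2 * x.1 + x.2.2.1 ^ 2 * x.2.1 ≠ 0}) :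
    (PairParam.defect (.inr (.inr x))).det = (1 - x.1.2.2.2) ^ 2 -
      (1 + x.1.2.2.1) * (1 - x.1.2.2.2) * x.1.1 + (1 + x.1.2.2.1) ^ 2 * x.1.2.1 := by
  simp [PairParam.defect, PairParam.A, PairParam.B, companion, Matrix.det_fin_two]
  ring

/-- Singularity says that m = (1 - v)/(1 + u) is a root of X^2 - tX + d; n is the other root. -/
theorem exists_root_pair {t d u v : F} (hu : u ≠ -1)
    (h : (1 - v) ^ 2 - (1 + u) * (1 - v) * t + (1 + u) ^ 2 * d = 0) :
    ∃ m n : F, t = m + n ∧ d = m * n ∧ v = 1 - (1 + u) * m := by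
  have hu1 : 1 + u ≠ 0 := fun e => hu (eq_neg_of_add_eq_zero_right e)
  obtain ⟨m, hm⟩ : ∃ m, (1 + u) * m = 1 - v := ⟨(1 - v) / (1 + u), mul_div_cancel₀ _ hu1⟩
  rw [← hm] at h
  refine ⟨m, t - m, by ring, mul_left_cancel₀ (pow_ne_zero 2 hu1) ?_, by rw [hm]; ring⟩
  linear_combination h

end Defect

/-! ### Counting the parameters. -/

section Counting

theorem natCard_not_mem {F : Type*} [Fintype F] [DecidableEq F] (s : Finset F) :
    (Nat.card {x : F // x ∉ s} : ℤ) = Fintype.card F - s.card := by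
  rw [Nat.card_eq_fintype_card, Fintype.card_subtype_compl, Fintype.card_coe,
    Nat.cast_sub (Finset.card_le_univ s)]

theorem natCard_ne {F : Type*} [Fintype F] [DecidableEq F] (a : F) : (Nat.card {x : F // x ≠ a} : ℤ) = Fintype.card F - 1 := by
  simpa using natCard_not_mem {a}

theorem natCard_ne_ne {F : Type*} [Fintype F] [DecidableEq F] {a b : F} (h : a ≠ b) :
    (Nat.card {x : F // x ≠ a ∧ x ≠ b} : ℤ) = Fintype.card F - 2 := by
  simpa [Finset.card_pair h] using natCard_not_mem {a, b}

theorem natCard_subtype_prod {α β : Type*} [Fintype α] [Finite β] (P : α × β → Prop) :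
    (Nat.card {x : α × β // P x} : ℤ) = ∑ a, (Nat.card {b : β // P (a, b)} : ℤ) := by
  have e : {x : α × β // P x} ≃ Σ a, {b : β // P (a, b)} :=
    { toFun := fun x => ⟨x.1.1, x.1.2, x.2⟩
      invFun := fun x => ⟨(x.1, x.2.1), x.2.2⟩
      left_inv := fun _ => rfl
      right_inv := fun _ => rfl }
  rw [Nat.card_congr e, Nat.card_sigma]
  push_cast
  rfl

variable {F : Type*} [Field F] [Fintype F] [DecidableEq F]

theorem natCard_linear_ne (b c : F) :
    (Nat.card {t : F // c + b * t ≠ 0} : ℤ) =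
      if b = 0 then (if c = 0 then 0 else (Fintype.card F : ℤ)) else (Fintype.card F : ℤ) - 1 := by
  split_ifs with hb hc
  · subst hb hc
    simp
  · subst hb
    simp [hc]
  · rw [← natCard_ne (-c / b)]
    congr 1
    refine Nat.card_congr (Equiv.subtypeEquivRight fun t => not_congr ?_)
    rw [eq_div_iff hb, mul_comm]
    exact ⟨fun h => by linear_combination h, fun h => by linear_combination h⟩

variable (F)

theorem natCard_pairParam : (Nat.card (PairParam F) : ℤ) =
    (Fintype.card F - 1) ^ 2 + Fintype.card F * (Fintype.card F - 1) ^ 2 +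
      (Fintype.card F - 1) * ((Fintype.card F - 1) ^ 3 +
        2 * Fintype.card F * (Fintype.card F - 1)) := by
  have h1 : (Nat.card {x : F × F // x.1 ≠ 0 ∧ x.2 ≠ 0} : ℤ) = (Fintype.card F - 1) ^ 2 := by
    rw [Nat.card_congr (Equiv.subtypeProdEquivProd (p := fun x : F => x ≠ 0)
      (q := fun x : F => x ≠ 0)), Nat.card_prod]
    push_cast
    rw [natCard_ne]
    ring
  have h2 : (Nat.card {x : F × F × F // x.1 ≠ 0 ∧ x.2.2 ≠ 0} : ℤ) =
      Fintype.card F * (Fintype.card F - 1) ^ 2 := by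
    have e : {x : F × F × F // x.1 ≠ 0 ∧ x.2.2 ≠ 0} ≃ F × {x : F × F // x.1 ≠ 0 ∧ x.2 ≠ 0} :=
      { toFun := fun x => ⟨x.1.2.1, ⟨(x.1.1, x.1.2.2), x.2⟩⟩
        invFun := fun x => ⟨(x.2.1.1, x.1, x.2.1.2), x.2.2⟩
        left_inv := fun _ => rfl
        right_inv := fun _ => rfl }
    rw [Nat.card_congr e, Nat.card_prod]
    push_cast
    rw [h1, Nat.card_eq_fintype_card]
  have h3 : (Nat.card {x : F × F × F × F // x.2.1 ≠ 0 ∧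
      x.2.2.2 ^ 2 + x.2.2.1 * x.2.2.2 * x.1 + x.2.2.1 ^ 2 * x.2.1 ≠ 0} : ℤ) =
      (Fintype.card F - 1) * ((Fintype.card F - 1) ^ 3 +
        2 * Fintype.card F * (Fintype.card F - 1)) := by
    -- The trace goes last because the determinant condition is linear in it.
    have e : {x : F × F × F × F // x.2.1 ≠ 0 ∧
        x.2.2.2 ^ 2 + x.2.2.1 * x.2.2.2 * x.1 + x.2.2.1 ^ 2 * x.2.1 ≠ 0} ≃
        {x : {d : F // d ≠ 0} × F × F × F //
          x.2.2.1 ^ 2 + x.2.1 ^ 2 * x.1.1 + x.2.1 * x.2.2.1 * x.2.2.2 ≠ 0} :=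
      { toFun := fun x => ⟨(⟨x.1.2.1, x.2.1⟩, x.1.2.2.1, x.1.2.2.2, x.1.1), by
          have := x.2.2
          rwa [add_right_comm] at this⟩
        invFun := fun x => ⟨(x.1.2.2.2, x.1.1.1, x.1.2.1, x.1.2.2.1), x.1.1.2, by
          have := x.2
          rwa [add_right_comm] at this⟩
        left_inv := fun _ => rfl
        right_inv := fun _ => rfl }
    rw [Nat.card_congr e, natCard_subtype_prod]
    have key (d : {d : F // d ≠ 0}) (a b : F) :
        (Nat.card {t : F // b ^ 2 + a ^ 2 * d.1 + a * b * t ≠ 0} : ℤ) =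
          (Fintype.card F - 1) + (if a = 0 then 1 else 0) + (if b = 0 then 1 else 0) -
            (if a = 0 then if b = 0 then (Fintype.card F : ℤ) + 1 else 0 else 0) := by
      rw [natCard_linear_ne]
      by_cases ha : a = 0 <;> by_cases hb : b = 0 <;> simp [ha, hb, d.2]
    have key' (q : ℤ) : ∑ a : F, ∑ b : F, ((q - 1) + (if a = 0 then 1 else 0) +
        (if b = 0 then 1 else 0) - (if a = 0 then if b = 0 then q + 1 else 0 else 0)) =
        (q - 1) * Fintype.card F ^ 2 + 2 * Fintype.card F - (q + 1) := by
      have h (a : F) : ∑ b : F, ((q - 1) + (if a = 0 then 1 else 0) +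
          (if b = 0 then 1 else 0) - (if a = 0 then if b = 0 then q + 1 else 0 else 0)) =
          Fintype.card F * (q - 1) + 1 +
            (if a = 0 then Fintype.card F - (q + 1) else 0) := by
        by_cases ha : a = 0
        · simp [ha, Finset.sum_add_distrib, Finset.sum_sub_distrib]
          ring
        · simp [ha, Finset.sum_add_distrib]
          ring
      simp only [h]
      simp [Finset.sum_add_distrib]
      ring
    simp only [natCard_subtype_prod, key, key']
    rw [Finset.sum_const, Finset.card_univ, nsmul_eq_mul,
      ← Nat.card_eq_fintype_card (α := {d : F // d ≠ 0}), natCard_ne]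
    ring
  rw [Nat.card_sum, Nat.card_sum]
  push_cast
  rw [h1, h2, h3]
  ring

variable {F}

theorem natCard_singular_scalar :
    (Nat.card {x : {x : F × F // x.1 ≠ 0 ∧ x.2 ≠ 0} //
      (PairParam.defect (.inl x)).det = 0} : ℤ) = Fintype.card F - 2 := by
  rw [← natCard_ne_ne (zero_ne_one (α := F))]
  congr 1
  refine (Nat.card_eq_of_bijective (fun a => ⟨⟨(a.1, 1 - a.1), a.2.1,
    sub_ne_zero.2 a.2.2.symm⟩, (det_defect_inl _).2 (add_sub_cancel _ _)⟩)
    ⟨fun a b h => ?_, fun x => ?_⟩).symm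
  · exact Subtype.ext (congrArg (fun x => x.1.1.1) h)
  · obtain ⟨⟨⟨a, b⟩, ha, hb⟩, h⟩ := x
    rw [det_defect_inl] at h
    obtain rfl : b = 1 - a := eq_sub_of_add_eq' h
    exact ⟨⟨a, ha, (sub_ne_zero.1 hb).symm⟩, rfl⟩

theorem natCard_singular_companion :
    (Nat.card {x : {x : F × F × F // x.1 ≠ 0 ∧ x.2.2 ≠ 0} //
      (PairParam.defect (.inr (.inl x))).det = 0} : ℤ) =
      (Fintype.card F - 2) * (Fintype.card F - 1) := by
  rw [← natCard_ne_ne (zero_ne_one (α := F)), ← natCard_ne (0 : F), ← Nat.cast_mul,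
    ← Nat.card_prod]
  congr 1
  refine (Nat.card_eq_of_bijective (fun x => ⟨⟨(x.1.1, (1 - x.1.1) + x.2.1 / (1 - x.1.1), x.2.1),
    x.1.2.1, x.2.2⟩, by
      rw [det_defect_inr_inl]
      have : 1 - x.1.1 ≠ 0 := sub_ne_zero.2 x.1.2.2.symm
      field_simp
      ring⟩) ⟨fun x y h => ?_, fun x => ?_⟩).symm
  · exact Prod.ext (Subtype.ext (congrArg (fun x => x.1.1.1) h))
      (Subtype.ext (congrArg (fun x => x.1.1.2.2) h))
  · obtain ⟨⟨⟨a, t, d⟩, ha, hd⟩, h⟩ := x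
    rw [det_defect_inr_inl] at h
    have ha1 : a ≠ 1 := by
      rintro rfl
      exact hd (by simpa using h)
    have h1 : 1 - a ≠ 0 := sub_ne_zero.2 ha1.symm
    refine ⟨(⟨a, ha, ha1⟩, ⟨d, hd⟩), ?_⟩
    simp only [Subtype.mk.injEq, Prod.mk.injEq, and_true, true_and]
    field_simp
    simp only at h
    linear_combination h

theorem natCard_root_pairs (m : {m : F // m ≠ 0 ∧ m ≠ 1}) :
    (Nat.card {x : {u : F // u ≠ -1} × F // x.2 ≠ 0 ∧ x.1.1 * x.2 ≠ x.1.1 * m.1 + m.1 - 1} : ℤ) =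
      (Fintype.card F - 1) * (Fintype.card F - 2) + 2 := by
  obtain ⟨m, hm0, hm1⟩ := m
  -- In general two distinct values of n are excluded. For u = 0 the second exclusion is void, and
  -- for u = m⁻¹ - 1 the two coincide; each of these gains one value.
  have key (u : {u : F // u ≠ -1}) :
      (Nat.card {n : F // n ≠ 0 ∧ u.1 * n ≠ u.1 * m + m - 1} : ℤ) =
        (Fintype.card F - 2) + (if u = ⟨0, by simp⟩ then 1 else 0) +
          (if u = ⟨m⁻¹ - 1, by simpa using hm0⟩ then 1 else 0) := by
    obtain ⟨u, hu⟩ := u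
    simp only [Subtype.mk.injEq]
    by_cases h0 : u = 0
    · subst h0
      have h1 : ¬ (0 = m⁻¹ - 1) := by
        intro h
        exact hm1 (inv_eq_one.1 (sub_eq_zero.1 h.symm))
      have h2 : (0 : F) ≠ m - 1 := (sub_ne_zero.2 hm1).symm
      have := natCard_ne (0 : F)
      simp only [zero_mul, zero_add, ne_eq, h2, not_false_eq_true, and_true, h1, if_true,
        if_false] at this ⊢
      rw [this]
      ring
    · have hdiv (n : F) : u * n ≠ u * m + m - 1 ↔ n ≠ (u * m + m - 1) / u := by
        rw [ne_eq, ne_eq, eq_div_iff h0, mul_comm]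
      simp only [hdiv, h0, if_false]
      have hz : (u * m + m - 1) / u = 0 ↔ u = m⁻¹ - 1 := by
        rw [div_eq_zero_iff, or_iff_left h0]
        constructor
        · intro h
          field_simp
          linear_combination h
        · rintro rfl
          field_simp
          ring
      by_cases h : u = m⁻¹ - 1
      · rw [hz.2 h, if_pos h]
        simp only [and_self]
        rw [natCard_ne]
        ring
      · rw [natCard_ne_ne (fun e => h (hz.1 e.symm)), if_neg h]
        ring
  rw [natCard_subtype_prod]
  simp only [key]
  rw [Finset.sum_add_distrib, Finset.sum_add_distrib, Finset.sum_const, Finset.card_univ,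
    nsmul_eq_mul, ← Nat.card_eq_fintype_card (α := {u : F // u ≠ -1}), natCard_ne]
  simp
  ring

/-- Here v = 1 and B = 1 - A, so the free parameters are det A and det B = 1 - t + d. -/
theorem natCard_singular_polynomial_of_eq :
    (Nat.card {x : {x : {x : F × F × F × F //
        x.2.1 ≠ 0 ∧ x.2.2.2 ^ 2 + x.2.2.1 * x.2.2.2 * x.1 + x.2.2.1 ^ 2 * x.2.1 ≠ 0} //
      (PairParam.defect (.inr (.inr x))).det = 0} // x.1.1.2.2.1 = -1} : ℤ) =
      (Fintype.card F - 1) ^ 2 := by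
  have h : (Nat.card ({d : F // d ≠ 0} × {s : F // s ≠ 0}) : ℤ) = (Fintype.card F - 1) ^ 2 := by
    rw [Nat.card_prod]
    push_cast
    rw [natCard_ne]
    ring
  rw [← h]
  congr 1
  refine (Nat.card_eq_of_bijective (fun x => ⟨⟨⟨(1 + x.1.1 - x.2.1, x.1.1, -1, 1), x.1.2, by
      have := x.2.2
      ring_nf
      exact this⟩, by
      rw [det_defect_inr_inr]
      ring⟩, rfl⟩) ⟨fun x y h => ?_, fun x => ?_⟩).symm
  · have h1 : x.1.1 = y.1.1 := congrArg (fun x => x.1.1.1.2.1) h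
    have h2 : 1 + x.1.1 - x.2.1 = 1 + y.1.1 - y.2.1 := congrArg (fun x => x.1.1.1.1) h
    rw [h1] at h2
    exact Prod.ext (Subtype.ext h1) (Subtype.ext (sub_right_injective h2))
  · obtain ⟨⟨⟨⟨t, d, u, v⟩, hd, hn⟩, h⟩, hu⟩ := x
    rw [det_defect_inr_inr] at h
    simp only at hu h hn
    subst hu
    obtain rfl : 1 = v := by simpa [sub_eq_zero] using h
    refine ⟨(⟨d, hd⟩, ⟨1 - t + d, ?_⟩), ?_⟩
    · ring_nf at hn ⊢
      exact hn
    · simp only [Subtype.mk.injEq, Prod.mk.injEq, and_true]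
      ring

/-- The parameters are u and the eigenvalues m, n of A, where m is singled out by u and v, so no
pair is counted twice. -/
theorem natCard_singular_polynomial_of_ne :
    (Nat.card {x : {x : {x : F × F × F × F //
        x.2.1 ≠ 0 ∧ x.2.2.2 ^ 2 + x.2.2.1 * x.2.2.2 * x.1 + x.2.2.1 ^ 2 * x.2.1 ≠ 0} //
      (PairParam.defect (.inr (.inr x))).det = 0} // ¬ x.1.1.2.2.1 = -1} : ℤ) =
      (Fintype.card F - 2) * ((Fintype.card F - 1) * (Fintype.card F - 2) + 2) := by
  have h : (Nat.card (Σ m : {m : F // m ≠ 0 ∧ m ≠ 1}, {x : {u : F // u ≠ -1} × F //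
      x.2 ≠ 0 ∧ x.1.1 * x.2 ≠ x.1.1 * m.1 + m.1 - 1}) : ℤ) =
      (Fintype.card F - 2) * ((Fintype.card F - 1) * (Fintype.card F - 2) + 2) := by
    rw [Nat.card_sigma]
    push_cast
    simp only [natCard_root_pairs]
    rw [Finset.sum_const, Finset.card_univ, nsmul_eq_mul,
      ← Nat.card_eq_fintype_card (α := {m : F // m ≠ 0 ∧ m ≠ 1}), natCard_ne_ne zero_ne_one]
  -- This is det B as the product of the eigenvalues v + um and v + un of B.
  have e (m n u : F) : (1 - (1 + u) * m) ^ 2 + u * (1 - (1 + u) * m) * (m + n) +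
      u ^ 2 * (m * n) = (1 - m) * (u * n - (u * m + m - 1)) := by ring
  rw [← h]
  congr 1
  refine (Nat.card_eq_of_bijective (fun x => ⟨⟨⟨(x.1.1 + x.2.1.2, x.1.1 * x.2.1.2, x.2.1.1.1,
    1 - (1 + x.2.1.1.1) * x.1.1), mul_ne_zero x.1.2.1 x.2.2.1, by
      rw [e]
      exact mul_ne_zero (sub_ne_zero.2 x.1.2.2.symm) (sub_ne_zero.2 x.2.2.2)⟩, by
      rw [det_defect_inr_inr]
      ring⟩, x.2.1.1.2⟩) ⟨?_, fun x => ?_⟩).symm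
  · rintro ⟨⟨m, hm⟩, ⟨⟨⟨u, hu⟩, n⟩, hn⟩⟩ ⟨⟨m', hm'⟩, ⟨⟨⟨u', hu'⟩, n'⟩, hn'⟩⟩ h
    simp only [Subtype.mk.injEq, Prod.mk.injEq] at h
    obtain ⟨h1, -, rfl, h2⟩ := h
    have hu1 : 1 + u ≠ 0 := fun e => hu (eq_neg_of_add_eq_zero_right e)
    obtain rfl : m = m' := mul_left_cancel₀ hu1 (sub_right_injective h2)
    obtain rfl : n = n' := add_left_cancel h1
    rfl
  · obtain ⟨⟨⟨⟨t, d, u, v⟩, hd, hn⟩, h⟩, hu⟩ := x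
    rw [det_defect_inr_inr] at h
    simp only at hu h hn hd
    obtain ⟨m, n, rfl, rfl, rfl⟩ := exists_root_pair hu h
    rw [e] at hn
    have h1 := sub_ne_zero.1 (left_ne_zero_of_mul hn)
    have h2 := sub_ne_zero.1 (right_ne_zero_of_mul hn)
    exact ⟨⟨⟨m, left_ne_zero_of_mul hd, h1.symm⟩, ⟨(⟨u, hu⟩, n), right_ne_zero_of_mul hd, h2⟩⟩, rfl⟩

theorem natCard_singular : (Nat.card {b : PairParam F // b.defect.det = 0} : ℤ) =
    (Fintype.card F - 2) + (Fintype.card F - 2) * (Fintype.card F - 1) +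
      (Fintype.card F - 1) ^ 2 +
      (Fintype.card F - 2) * ((Fintype.card F - 1) * (Fintype.card F - 2) + 2) := by
  rw [Nat.card_congr Equiv.subtypeSum, Nat.card_sum, Nat.card_congr Equiv.subtypeSum,
    Nat.card_sum, ← Nat.card_congr (Equiv.sumCompl fun x : {x : {x : F × F × F × F //
      x.2.1 ≠ 0 ∧ x.2.2.2 ^ 2 + x.2.2.1 * x.2.2.2 * x.1 + x.2.2.1 ^ 2 * x.2.1 ≠ 0} //
      (PairParam.defect (.inr (.inr x))).det = 0} => x.1.1.2.2.1 = -1), Nat.card_sum]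
  push_cast
  rw [natCard_singular_scalar, natCard_singular_companion, natCard_singular_polynomial_of_eq,
    natCard_singular_polynomial_of_ne]
  ring

theorem natCard_normalParam : (Nat.card (NormalParam F) : ℤ) =
    (Fintype.card F : ℤ) ^ 4 - (Fintype.card F : ℤ) ^ 2 - (Fintype.card F : ℤ) - 1 := by
  have h : (Nat.card (NormalParam F) : ℤ) = Nat.card (PairParam F) +
      (Nat.card {b : PairParam F // b.defect.det = 0} + Nat.card (EigenParam F)) := by
    rw [Nat.card_sum, Nat.card_sum (α := {b : PairParam F // b.defect.det = 0})]
    push_cast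
    rfl
  rw [h, Nat.card_prod, natCard_pairParam, natCard_singular]
  push_cast
  rw [natCard_ne_ne zero_ne_one]
  ring

end Counting

end MedialCount

theorem theorem1 (p : ℕ) (hp : p.Prime) :
    (mq.{u, 0} (Fin 2 → ZMod p) : ℤ) = (p : ℤ) ^ 4 - (p : ℤ) ^ 2 - (p : ℤ) - 1 := by
  have : Fact p.Prime := ⟨hp⟩
  rw [MedialCount.mq_eq_card_normalParam, MedialCount.natCard_normalParam, ZMod.card]
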